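/- Let $n,m\ge 0$ be integers, let $\mathcal X_1,\dots,\mathcal X_n$ and $\mathcal H_1,\dots,\mathcal H_m$ be finite non-empty sets (the state spaces of the visible and of the hidden units), and put $N_i=|\mathcal X_i|$, $M_j=|\mathcal H_j|$, $\mathcal X=\prod_i\mathcal X_i$, $\mathcal H=\prod_j\mathcal H_j$, and $N_B=\prod_{i\in B}N_i$ for $B\subseteq[n]$. The restricted Boltzmann machine $\mathrm{RBM}_{n,m}$ is the set of all probability distributions on $\mathcal X$ of the form $$q(x)=\frac1Z\sum_{h\in\mathcal H}\exp\Big(\sum_{i\in[n]}\sum_{j\in[m]}W_{ij}(x_i,h_j)+\sum_{i\in[n]}b_i(x_i)+\sum_{j\in[m]}c_j(h_j)\Big),\qquad x\in\mathcal X,$$ with arbitrary real-valued functions $W_{ij}$ on $\mathcal X_i\times\mathcal H_j$, $b_i$ on $\mathcal X_i$ and $c_j$ on $\mathcal H_j$, where $Z$ is the normalising constant. For a set $\mathcal M$ of probability distributions on $\mathcal X$ let $$D_{\mathcal M}=\sup_{p}\,\inf_{q\in\mathcal M}D(p\|q),\qquad D(p\|q)=\sum_{x\in\mathcal X}p(x)\log\frac{p(x)}{q(x)},$$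 where $p$ runs over all probability distributions on $\mathcal X$ (and $D(p\|q)=\infty$ if $q(x)=0<p(x)$ for some $x$); $\log$ is the natural logarithm. (i) If $A\subseteq[n]$ is non-empty and $1+\sum_{j\in[m]}(M_j-1)\ge N_{[n]\setminus A}$, then $$D_{\mathrm{RBM}_{n,m}}\le\log\Big(\frac{N_A}{\max_{j\in A}N_j}\Big).$$ (ii) If all units are binary, that is, $N_i=2$ for all $i\in[n]$ and $M_j=2$ for all $j\in[m]$, and if $n\ge1$ and $m\le2^{n-1}-1$, then $$D_{\mathrm{RBM}_{n,m}}\le\Big(n-\lfloor\log_2(m+1)\rfloor-\frac{m+1}{2^{\lfloor\log_2(m+1)\rfloor}}\Big)\log 2.$$ -/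

import Mathlib

namespace InfoDiv

open Classical in
/-- The Kullback-Leibler divergence `D(p‖q) = ∑ₓ p(x) log (p(x) / q(x))` of two probability vectors
on a finite set, with the usual conventions: a term with `p(x) = 0` is zero, and the value is `⊤`
if `q(x) = 0 < p(x)` for some `x`. -/
noncomputable def kl {α : Type*} [Fintype α] (p q : α → ℝ) : EReal :=
  if ∀ x, q x = 0 → p x = 0 then ((∑ x, p x * Real.log (p x / q x) : ℝ) : EReal) else ⊤

/-- The divergence `D(p‖M) = inf_{q ∈ M} D(p‖q)` from `p` to the model `M`. -/
noncomputable def divFrom {α : Type*} [Fintype α] (p : α → ℝ) (M : Set (α → ℝ)) : EReal :=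
  ⨅ q ∈ M, kl p q

/-- The maximal divergence `D_M` from the model `M`: the supremum of `D(p‖M)` over all
probability vectors `p`. -/
noncomputable def maxDiv {α : Type*} [Fintype α] (M : Set (α → ℝ)) : EReal :=
  ⨆ p ∈ stdSimplex ℝ α, divFrom p M

section RBM

variable {n m : ℕ} {X : Fin n → Type*} {H : Fin m → Type*}

/-- The unnormalised joint weight of a visible state `x` and a hidden state `h`: the exponential of
the sum of a pair interaction for each edge of the complete bipartite graph between the visible
and the hidden units and of a bias for each unit. -/
noncomputable def rbmWeight (W : ∀ i j, X i → H j → ℝ) (b : ∀ i, X i → ℝ) (c : ∀ j, H j → ℝ)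
    (x : ∀ i, X i) (h : ∀ j, H j) : ℝ :=
  Real.exp (∑ i, ∑ j, W i j (x i) (h j) + ∑ i, b i (x i) + ∑ j, c j (h j))

variable [∀ i, Fintype (X i)] [∀ j, Fintype (H j)]

/-- The distribution of the visible units: the marginal of the normalised joint distribution. -/
noncomputable def rbmVisible (W : ∀ i j, X i → H j → ℝ) (b : ∀ i, X i → ℝ) (c : ∀ j, H j → ℝ)
    (x : ∀ i, X i) : ℝ :=
  (∑ h, rbmWeight W b c x h) / ∑ y, ∑ h, rbmWeight W b c y h

variable (X H) in
/-- The restricted Boltzmann machine with visible state spaces `X i` and hidden state spaces `H j`: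
the set of all visible distributions, for all real values of the parameters. -/
def RBM : Set ((∀ i, X i) → ℝ) :=
  {p | ∃ (W : ∀ i j, X i → H j → ℝ) (b : ∀ i, X i → ℝ) (c : ∀ j, H j → ℝ),
    p = rbmVisible W b c}

/-- The elements of the model are probability distributions on the visible state space. -/
theorem rbm_subset_stdSimplex [∀ i, Nonempty (X i)] [∀ j, Nonempty (H j)] :
    RBM X H ⊆ stdSimplex ℝ (∀ i, X i) := by
  rintro p ⟨W, b, c, rfl⟩
  have hpos : ∀ x, 0 < ∑ h, rbmWeight W b c x h := fun x =>
    Finset.sum_pos (fun h _ => Real.exp_pos _) Finset.univ_nonempty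
  have hZ : 0 < ∑ y, ∑ h, rbmWeight W b c y h :=
    Finset.sum_pos (fun y _ => hpos y) Finset.univ_nonempty
  refine ⟨fun x => (div_pos (hpos x) hZ).le, ?_⟩
  simp only [rbmVisible]
  rw [← Finset.sum_div, div_self hZ.ne']

end RBM

end InfoDiv

/-!
Given the visible state the hidden units are independent, so summing them out turns the weight of
a visible state into a product over the hidden units of sums of `M_j` product functions. Normalise
one summand of each factor to `1` and let different factors have disjoint supports in the limit:
the product collapses to a sum, and the closure of the model contains every mixture of
`1 + ∑ j, (M_j - 1)` product distributions with disjoint supports.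

So partition `𝒳` into that many boxes `∏ i, S i`. On each box replace `p` by the product function
with the marginal of `p` at one coordinate `t` and uniform at the other coordinates. It is at
least `p / ∏ i ≠ t, |S i|`, so the divergence is at most the mean of `∑ i ≠ t, log |S i|` under
`p`. For (i) the boxes are the cylinders over the complement of `A` and `t` is the largest unit in
`A`. For (ii) they are the cylinders over `k = ⌊log₂ (m + 1)⌋` units, and the remaining
`m + 1 - 2 ^ k` boxes are spent on halving the heaviest cylinders, which saves `log 2` on a
fraction of at least `(m + 1) / 2 ^ k - 1` of the mass.
-/

namespace InfoDiv

open Finset Filter Topology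

section Divergence

variable {α : Type*} [Fintype α] {p q : α → ℝ}

theorem continuousAt_kl (h : ∀ x, q x = 0 → p x = 0) : ContinuousAt (kl p) q := by
  have h_finite : ∀ᶠ q' in 𝓝 q, ∀ x, q' x = 0 → p x = 0 := by
    refine eventually_all.2 fun x => ?_
    by_cases hx : p x = 0
    · exact .of_forall fun _ _ => hx
    · filter_upwards [(continuousAt_apply x q).eventually_ne (mt (h x) hx)] with q' hq' h0
      exact absurd h0 hq'
  have h_kl : (fun q' => ((∑ x, p x * Real.log (p x / q' x) : ℝ) : EReal)) =ᶠ[𝓝 q] kl p := by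
    filter_upwards [h_finite] with q' hq' using (if_pos hq').symm
  refine ContinuousAt.congr (continuous_coe_real_ereal.continuousAt.comp ?_) h_kl
  refine tendsto_finsetSum _ fun x _ => ?_
  by_cases hx : p x = 0
  · simp [hx]
  · have hqx : q x ≠ 0 := mt (h x) hx
    exact ((tendsto_const_nhds.div (continuousAt_apply x q) hqx).log
      (div_ne_zero hx hqx)).const_mul _

theorem divFrom_le_kl_of_mem_closure {M : Set (α → ℝ)} (hq : q ∈ closure M) :
    divFrom p M ≤ kl p q := by
  by_cases h : ∀ x, q x = 0 → p x = 0
  · have h_image : kl p '' M ⊆ Set.Ici (divFrom p M) := by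
      rintro _ ⟨q', hq', rfl⟩
      exact iInf₂_le (f := fun q' _ => kl p q') q' hq'
    exact closure_minimal h_image isClosed_Ici (mem_closure_image (continuousAt_kl h) hq)
  · exact le_top.trans_eq (if_neg h).symm

theorem kl_le_sum_mul_log_of_le_mul {C : α → ℝ} (hp : ∀ x, 0 ≤ p x) (hC : ∀ x, 0 < C x)
    (hpq : ∀ x, p x ≤ C x * q x) : kl p q ≤ ((∑ x, p x * Real.log (C x) : ℝ) : EReal) := by
  have h_finite : ∀ x, q x = 0 → p x = 0 := fun x hx =>
    (hp x).antisymm' (by simpa [hx] using hpq x)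
  rw [kl, if_pos h_finite, EReal.coe_le_coe_iff]
  refine sum_le_sum fun x _ => ?_
  obtain hx | hx := (hp x).eq_or_lt
  · simp [← hx]
  · have hqx : 0 < q x := pos_of_mul_pos_right (hx.trans_le (hpq x)) (hC x).le
    gcongr
    exact (div_le_iff₀ hqx).2 (hpq x)

end Divergence

section Sums

theorem prod_one_add_of_pairwise_mul_eq_zero {ι R : Type*} [CommSemiring R] {s : Finset ι}
    {a : ι → R} (h : (s : Set ι).Pairwise fun i j => a i * a j = 0) :
    ∏ i ∈ s, (1 + a i) = 1 + ∑ i ∈ s, a i := by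
  classical
  induction s using Finset.induction_on with
  | empty => simp
  | insert i s hi ih =>
    have h_cross : a i * ∑ j ∈ s, a j = 0 := by
      rw [mul_sum]
      exact sum_eq_zero fun j hj => h (mem_insert_self i s) (mem_insert_of_mem hj)
        (ne_of_mem_of_not_mem hj hi).symm
    rw [prod_insert hi, sum_insert hi, ih (h.mono (coe_subset.2 (subset_insert i s))), mul_add,
      mul_one, add_mul, h_cross, one_mul, add_zero, add_assoc]

theorem exists_subset_card_eq_nsmul_sum_le {α M : Type*} [AddCommMonoid M] [LinearOrder M]
    [IsOrderedAddMonoid M] (w : α → M) {r : ℕ} {S : Finset α} (hr : r ≤ #S) :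
    ∃ R ⊆ S, #R = r ∧ r • ∑ a ∈ S, w a ≤ #S • ∑ a ∈ R, w a := by
  classical
  induction S using Finset.induction_on_min_value w with
  | empty => exact ⟨∅, Subset.rfl, (Nat.le_zero.1 hr).symm, by simp⟩
  | insert a S ha hmin ih =>
    obtain rfl | hlt := hr.eq_or_lt
    · exact ⟨insert a S, Subset.rfl, rfl, le_rfl⟩
    rw [card_insert_of_notMem ha] at hlt ⊢
    obtain ⟨R, hRS, hRr, hR⟩ := ih (Nat.lt_succ_iff.1 hlt)
    refine ⟨R, hRS.trans (subset_insert a S), hRr, ?_⟩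
    have h_min : r • w a ≤ ∑ b ∈ R, w b :=
      hRr ▸ card_nsmul_le_sum R w (w a) fun b hb => hmin b (hRS hb)
    rw [sum_insert ha, nsmul_add, succ_nsmul']
    exact add_le_add h_min hR

theorem exists_card_eq_and_div_card_le_sum_filter {α κ : Type*} [Fintype α] [Fintype κ]
    [DecidableEq κ] {p : α → ℝ} (hp : p ∈ stdSimplex ℝ α) (f : α → κ) {r : ℕ}
    (hr : r ≤ Fintype.card κ) :
    ∃ R : Finset κ, #R = r ∧ (r : ℝ) / Fintype.card κ ≤ ∑ x with f x ∈ R, p x := by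
  obtain ⟨R, -, hRr, hR⟩ :=
    exists_subset_card_eq_nsmul_sum_le (S := univ) (fun k => ∑ x with f x = k, p x) hr
  refine ⟨R, hRr, div_le_of_le_mul₀ (Nat.cast_nonneg _) (sum_nonneg fun x _ => hp.1 x) ?_⟩
  rw [sum_fiberwise, hp.2, sum_fiberwise_eq_sum_filter] at hR
  simpa [mul_comm] using hR

end Sums

section ProductFunctions

variable {ι : Type*} [Fintype ι] {X : ι → Type*} {s : Set ℝ}

variable (X s) in
/-- The functions `x ↦ ∏ i, f i (x i)` on a product space whose factors `f i` take values in `s`.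
With `s = Ioi 0` and `s = Ici 0` these are the positive and the nonnegative multiples of product
distributions. -/
def productFunctions : Set ((∀ i, X i) → ℝ) :=
  (fun (f : ∀ i, X i → ℝ) x => ∏ i, f i (x i)) '' {f | ∀ i a, f i a ∈ s}

theorem productFunctions_closure_subset :
    productFunctions X (closure s) ⊆ closure (productFunctions X s) := by
  rintro _ ⟨f, hf, rfl⟩
  have hf_closure : f ∈ closure (Set.univ.pi fun i => Set.univ.pi fun _ : X i => s) := by
    simp only [closure_pi_set, Set.mem_univ_pi]
    exact hf
  exact map_mem_closure (f := fun (f : ∀ i, X i → ℝ) (x : ∀ i, X i) => ∏ i, f i (x i)) (by fun_prop)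
    hf_closure fun g hg => ⟨g, fun i a => hg i trivial a trivial, rfl⟩

theorem productFunctions_Ici_subset_closure_productFunctions_Ioi :
    productFunctions X (Set.Ici 0) ⊆ closure (productFunctions X (Set.Ioi 0)) :=
  closure_Ioi (0 : ℝ) ▸ productFunctions_closure_subset

theorem pos_of_mem_productFunctions_Ioi {F : (∀ i, X i) → ℝ}
    (hF : F ∈ productFunctions X (Set.Ioi 0)) (x : ∀ i, X i) : 0 < F x := by
  obtain ⟨f, hf, rfl⟩ := hF
  exact prod_pos fun i _ => hf i (x i)

theorem div_mem_productFunctions_Ioi {F G : (∀ i, X i) → ℝ}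
    (hF : F ∈ productFunctions X (Set.Ioi 0)) (hG : G ∈ productFunctions X (Set.Ioi 0)) :
    F / G ∈ productFunctions X (Set.Ioi 0) := by
  obtain ⟨f, hf, rfl⟩ := hF
  obtain ⟨g, hg, rfl⟩ := hG
  exact ⟨fun i a => f i a / g i a, fun i a => Set.mem_Ioi.2 (div_pos (hf i a) (hg i a)),
    funext fun x => prod_div_distrib _ _⟩

theorem one_mem_productFunctions_Ioi : 1 ∈ productFunctions X (Set.Ioi 0) :=
  ⟨fun _ _ => 1, fun _ _ => Set.mem_Ioi.2 one_pos, funext fun _ => prod_const_one⟩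

theorem zero_mem_productFunctions_Ici [Nonempty ι] : 0 ∈ productFunctions X (Set.Ici 0) :=
  ⟨fun _ _ => 0, fun _ _ => Set.self_mem_Ici, funext fun _ => by simp⟩

end ProductFunctions

section Closure

variable {n m : ℕ} {X : Fin n → Type*} {H : Fin m → Type*} [∀ j, Fintype (H j)]

variable (X H) in
/-- The unnormalised visible distributions of the restricted Boltzmann machine. Limits
are taken in this set, which keeps the normalising constant out of them. -/
def rbmWeights : Set ((∀ i, X i) → ℝ) :=
  {u | ∃ (W : ∀ i j, X i → H j → ℝ) (b : ∀ i, X i → ℝ) (c : ∀ j, H j → ℝ),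
    u = fun x => ∑ h, rbmWeight W b c x h}

theorem mul_prod_sum_mem_rbmWeights {F : (∀ i, X i) → ℝ} {G : ∀ j, H j → (∀ i, X i) → ℝ}
    (hF : F ∈ productFunctions X (Set.Ioi 0))
    (hG : ∀ j h, G j h ∈ productFunctions X (Set.Ioi 0)) :
    F * ∏ j, ∑ h, G j h ∈ rbmWeights X H := by
  classical
  obtain ⟨f, hf, rfl⟩ := hF
  choose g hg hgG using hG
  refine ⟨fun i j a h => Real.log (g j h i a), fun i a => Real.log (f i a), fun _ _ => 0, ?_⟩
  funext x
  have h_exp_log_f : ∀ i, Real.exp (Real.log (f i (x i))) = f i (x i) := fun i =>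
    Real.exp_log (hf i (x i))
  have h_exp_log_g : ∀ j h i, Real.exp (Real.log (g j h i (x i))) = g j h i (x i) :=
    fun j h i => Real.exp_log (hg j h i (x i))
  simp only [← hgG, Pi.mul_apply, Finset.prod_apply, Finset.sum_apply, Fintype.prod_sum, mul_sum,
    rbmWeight, sum_const_zero, add_zero, Real.exp_add, Real.exp_sum, h_exp_log_f, h_exp_log_g]
  refine sum_congr rfl fun h _ => ?_
  rw [mul_comm, Finset.prod_comm]

theorem mul_prod_one_add_sum_mem_rbmWeights [∀ j, DecidableEq (H j)] (h₀ : ∀ j, H j)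
    {F : (∀ i, X i) → ℝ} {G : ∀ j, {h // h ≠ h₀ j} → (∀ i, X i) → ℝ}
    (hF : F ∈ productFunctions X (Set.Ioi 0))
    (hG : ∀ j h, G j h ∈ productFunctions X (Set.Ioi 0)) :
    F * ∏ j, (1 + ∑ h, G j h) ∈ rbmWeights X H := by
  let G' : ∀ j, H j → (∀ i, X i) → ℝ := fun j h => if hh : h ≠ h₀ j then G j ⟨h, hh⟩ else 1
  have hG' : ∀ j h, G' j h ∈ productFunctions X (Set.Ioi 0) := by
    intro j h
    by_cases hh : h ≠ h₀ j
    · simpa only [G', dif_pos hh] using hG j ⟨h, hh⟩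
    · simpa only [G', dif_neg hh] using one_mem_productFunctions_Ioi
  have h_sum : ∀ j, ∑ h, G' j h = 1 + ∑ h, G j h := by
    intro j
    rw [Fintype.sum_eq_add_sum_subtype_ne _ (h₀ j)]
    congr 1
    · simp [G']
    · exact sum_congr rfl fun h _ => dif_pos h.2
  simpa only [h_sum] using mul_prod_sum_mem_rbmWeights hF hG'

/-- With disjoint supports at most one factor of `F * ∏ j, (1 + ∑ h, G j h / F)` differs from `1`,
so the product is the sum. -/
theorem add_sum_mem_closure_rbmWeights_of_pos [∀ j, DecidableEq (H j)] (h₀ : ∀ j, H j)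
    {F : (∀ i, X i) → ℝ} {G : ∀ j, {h // h ≠ h₀ j} → (∀ i, X i) → ℝ}
    (hF : F ∈ productFunctions X (Set.Ioi 0))
    (hG : ∀ j h, G j h ∈ productFunctions X (Set.Ici 0))
    (hdisj : Pairwise fun j j' => ∀ h h', G j h * G j' h' = 0) :
    F + ∑ j, ∑ h, G j h ∈ closure (rbmWeights X H) := by
  have hG_closure : G ∈ closure (Set.univ.pi fun j => Set.univ.pi fun _ : {h // h ≠ h₀ j} =>
      productFunctions X (Set.Ioi 0)) := by
    simp only [closure_pi_set, Set.mem_univ_pi]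
    exact fun j h => productFunctions_Ici_subset_closure_productFunctions_Ioi (hG j h)
  have h_mem : F * ∏ j, (1 + ∑ h, G j h / F) ∈ closure (rbmWeights X H) := by
    refine map_mem_closure
      (f := fun G : ∀ j, {h // h ≠ h₀ j} → (∀ i, X i) → ℝ => F * ∏ j, (1 + ∑ h, G j h / F))
      ?_ hG_closure fun G' hG' => ?_
    · simp only [div_eq_mul_inv]
      fun_prop
    · exact mul_prod_one_add_sum_mem_rbmWeights h₀ hF fun j h =>
        div_mem_productFunctions_Ioi (hG' j trivial h trivial) hF
  have h_cross : Pairwise fun j j' => (∑ h, G j h / F) * (∑ h, G j' h / F) = 0 := by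
    intro j j' hj
    rw [sum_mul_sum]
    refine sum_eq_zero fun h _ => sum_eq_zero fun h' _ => ?_
    rw [div_eq_mul_inv, div_eq_mul_inv, mul_mul_mul_comm, hdisj hj, zero_mul]
  have hF_ne : ∀ x, F x ≠ 0 := fun x => (pos_of_mem_productFunctions_Ioi hF x).ne'
  rw [prod_one_add_of_pairwise_mul_eq_zero (h_cross.set_pairwise _)] at h_mem
  convert h_mem using 1
  funext x
  simp only [Pi.add_apply, Pi.mul_apply, Pi.one_apply, Finset.sum_apply, Pi.div_apply, ← sum_div,
    mul_add, mul_one, mul_div_cancel₀ _ (hF_ne x)]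

theorem add_sum_mem_closure_rbmWeights [∀ j, DecidableEq (H j)] (h₀ : ∀ j, H j)
    {F : (∀ i, X i) → ℝ} {G : ∀ j, {h // h ≠ h₀ j} → (∀ i, X i) → ℝ}
    (hF : F ∈ productFunctions X (Set.Ici 0))
    (hG : ∀ j h, G j h ∈ productFunctions X (Set.Ici 0))
    (hdisj : Pairwise fun j j' => ∀ h h', G j h * G j' h' = 0) :
    F + ∑ j, ∑ h, G j h ∈ closure (rbmWeights X H) := by
  rw [← closure_closure]
  exact map_mem_closure (f := fun F' => F' + ∑ j, ∑ h, G j h) (by fun_prop)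
    (productFunctions_Ici_subset_closure_productFunctions_Ioi hF) fun F' hF' =>
      add_sum_mem_closure_rbmWeights_of_pos h₀ hF' hG hdisj

/-- One summand is supplied by the visible biases and `|H j| - 1` summands by each hidden
unit `j`. -/
theorem sum_mem_closure_rbmWeights [∀ j, Nonempty (H j)] [Nonempty (Fin n)]
    {κ : Type*} [Fintype κ] (hκ : Fintype.card κ ≤ 1 + ∑ j, (Fintype.card (H j) - 1))
    {F : κ → (∀ i, X i) → ℝ} (hF : ∀ k, F k ∈ productFunctions X (Set.Ici 0))
    (hdisj : Pairwise fun k l => F k * F l = 0) :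
    ∑ k, F k ∈ closure (rbmWeights X H) := by
  classical
  let h₀ : ∀ j, H j := fun j => Classical.arbitrary (H j)
  have hκ_le : Fintype.card κ ≤ Fintype.card (Option (Σ j, {h : H j // h ≠ h₀ j})) := by
    rw [Fintype.card_option, Fintype.card_sigma, add_comm]
    simpa [Fintype.card_subtype_compl] using hκ
  obtain ⟨e⟩ := Function.Embedding.nonempty_of_card_le hκ_le
  let F' : Option (Σ j, {h : H j // h ≠ h₀ j}) → (∀ i, X i) → ℝ := Function.extend e F fun _ => 0
  have hF'_apply : ∀ k, F' (e k) = F k := fun k => e.injective.extend_apply F (fun _ => 0) k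
  have hF'_zero : ∀ o ∉ Set.range e, F' o = 0 := fun o ho =>
    Function.extend_apply' F (fun _ => 0) o ho
  have hF'_mem : ∀ o, F' o ∈ productFunctions X (Set.Ici 0) := by
    intro o
    by_cases ho : o ∈ Set.range e
    · obtain ⟨k, rfl⟩ := ho
      exact hF'_apply k ▸ hF k
    · exact hF'_zero o ho ▸ zero_mem_productFunctions_Ici
  have hF'_disj : Pairwise fun o o' => F' o * F' o' = 0 := by
    intro o o' hoo'
    by_cases ho : o ∈ Set.range e
    · by_cases ho' : o' ∈ Set.range e
      · obtain ⟨k, rfl⟩ := ho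
        obtain ⟨l, rfl⟩ := ho'
        simpa only [hF'_apply] using hdisj (ne_of_apply_ne e hoo')
      · rw [hF'_zero o' ho', mul_zero]
    · rw [hF'_zero o ho, zero_mul]
  have h_sum : ∑ k, F k = F' none + ∑ j, ∑ h, F' (some ⟨j, h⟩) := by
    rw [Fintype.sum_of_injective e e.injective F F' hF'_zero fun k => (hF'_apply k).symm,
      Fintype.sum_option, Fintype.sum_sigma]
  rw [h_sum]
  refine add_sum_mem_closure_rbmWeights h₀ (hF'_mem none) (fun j h => hF'_mem (some ⟨j, h⟩)) ?_
  exact fun j j' hj h h' => hF'_disj (by simp [hj])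

theorem mem_closure_RBM_of_mem_closure_rbmWeights [∀ i, Fintype (X i)] {u : (∀ i, X i) → ℝ}
    (hu : u ∈ closure (rbmWeights X H)) (hu_sum : ∑ x, u x = 1) : u ∈ closure (RBM X H) := by
  let normalize : ((∀ i, X i) → ℝ) → (∀ i, X i) → ℝ := fun v x => v x / ∑ y, v y
  have h_cont : ContinuousAt normalize u := by
    refine continuousAt_pi.2 fun x => ContinuousAt.div (continuousAt_apply x u)
      (continuous_finsetSum _ fun y _ => continuous_apply y).continuousAt ?_
    simp [hu_sum]
  have h_image : normalize '' rbmWeights X H ⊆ RBM X H := by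
    rintro _ ⟨_, ⟨W, b, c, rfl⟩, rfl⟩
    exact ⟨W, b, c, rfl⟩
  have h_fixed : normalize u = u := by simp [normalize, hu_sum]
  exact h_fixed ▸ closure_mono h_image (mem_closure_image h_cont hu)

end Closure

section Boxes

variable {ι : Type*} {X : ι → Type*} {κ : Type*}

variable (X κ) in
/-- A partition of a product space into boxes `∏ i, box k i` indexed by `k : κ`, where `part x` is
the index of the box containing `x`. Boxes are allowed to be empty. -/
structure BoxPartition where
  box : κ → ∀ i, Finset (X i)
  part : (∀ i, X i) → κ
  part_eq_iff : ∀ {x k}, part x = k ↔ ∀ i, x i ∈ box k i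

theorem BoxPartition.mem_box_part (P : BoxPartition X κ) (x : ∀ i, X i) (i : ι) :
    x i ∈ P.box (P.part x) i :=
  P.part_eq_iff.1 rfl i

variable [DecidableEq ι]

/-- The partition into cylinder sets, each of which fixes the coordinates in `B`. -/
def BoxPartition.cylinders [∀ i, Fintype (X i)] (B : Finset ι) :
    BoxPartition X (∀ i : B, X i) where
  box k i := if h : i ∈ B then {k ⟨i, h⟩} else univ
  part x i := x i
  part_eq_iff {x k} := by
    refine ⟨?_, fun hx => funext fun ⟨i, hi⟩ => by simpa [hi] using hx i⟩
    rintro rfl i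
    by_cases hi : i ∈ B <;> simp [hi]

theorem BoxPartition.sum_log_card_box_cylinders [∀ i, Fintype (X i)] (B s : Finset ι)
    (k : ∀ i : B, X i) :
    ∑ i ∈ s, Real.log #((cylinders B).box k i) = ∑ i ∈ s \ B, Real.log (Fintype.card (X i)) := by
  rw [sdiff_eq_filter, sum_filter]
  refine sum_congr rfl fun i _ => ?_
  by_cases hi : i ∈ B <;> simp [cylinders, hi]

section Split

variable [∀ i, DecidableEq (X i)] [DecidableEq κ]

/-- The refinement of a box partition that cuts each box in `R` into slices along the
coordinate `j`. -/
def BoxPartition.split (P : BoxPartition X κ) (R : Finset κ) (j : ι) :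
    BoxPartition X ({k // k ∉ R} ⊕ {k // k ∈ R} × X j) where
  box := Sum.elim (fun k => P.box k)
    fun ⟨k, a⟩ => Function.update (P.box k) j {b ∈ P.box k j | b = a}
  part x := if h : P.part x ∈ R then .inr (⟨P.part x, h⟩, x j) else .inl ⟨P.part x, h⟩
  part_eq_iff {x k} := by
    obtain k | ⟨k, a⟩ := k
    · rw [Sum.elim_inl, ← P.part_eq_iff]
      grind
    · have h_slice : (∀ i, x i ∈ Function.update (P.box k) j {b ∈ P.box k j | b = a} i) ↔
          (∀ i, x i ∈ P.box k i) ∧ x j = a := by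
        rw [Function.forall_update_iff _ fun i s => x i ∈ s, mem_filter]
        grind
      rw [Sum.elim_inr, h_slice, ← P.part_eq_iff]
      grind

theorem BoxPartition.sum_log_card_box_split (P : BoxPartition X κ) (R : Finset κ) {j : ι}
    {s : Finset ι} (hj : j ∈ s) (x : ∀ i, X i) :
    ∑ i ∈ s, Real.log #((P.split R j).box ((P.split R j).part x) i) =
      ∑ i ∈ s, Real.log #(P.box (P.part x) i) -
        if P.part x ∈ R then Real.log #(P.box (P.part x) j) else 0 := by
  by_cases hx : P.part x ∈ R
  · have h_slice : {b ∈ P.box (P.part x) j | b = x j} = {x j} := by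
      grind [P.mem_box_part x j]
    rw [if_pos hx, ← sum_erase_eq_sub hj, ← add_sum_erase _ _ hj]
    simp only [split, dif_pos hx, Sum.elim_inr, Function.update_self, h_slice, card_singleton,
      Nat.cast_one, Real.log_one, zero_add]
    refine sum_congr rfl fun i hi => ?_
    rw [Function.update_of_ne (ne_of_mem_erase hi)]
  · simp only [split, dif_neg hx, Sum.elim_inl, if_neg hx, sub_zero]

end Split

section BoxApprox

variable [Fintype ι] [∀ i, DecidableEq (X i)] {S : ∀ i, Finset (X i)} {t : ι}
  {p : (∀ i, X i) → ℝ}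

/-- The factors of `boxApprox`. -/
noncomputable def boxFactor (S : ∀ i, Finset (X i)) (t : ι) (p : (∀ i, X i) → ℝ) :
    ∀ i, X i → ℝ :=
  Function.update (fun i a => if a ∈ S i then (#(S i) : ℝ)⁻¹ else 0) t
    fun a => ∑ y ∈ Fintype.piFinset S with y t = a, p y

/-- The product function on the box `∏ i, S i` that has the same marginal at the coordinate `t` as
the restriction of `p` to the box and is uniform in all other coordinates. -/
noncomputable def boxApprox (S : ∀ i, Finset (X i)) (t : ι) (p : (∀ i, X i) → ℝ) :
    (∀ i, X i) → ℝ :=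
  fun x => ∏ i, boxFactor S t p i (x i)

theorem boxApprox_mem_productFunctions (hp : ∀ x, 0 ≤ p x) :
    boxApprox S t p ∈ productFunctions X (Set.Ici 0) := by
  refine ⟨boxFactor S t p, fun i a => ?_, rfl⟩
  obtain rfl | hi := eq_or_ne i t
  · rw [boxFactor, Function.update_self]
    exact sum_nonneg fun y _ => hp y
  · rw [boxFactor, Function.update_of_ne hi, Set.mem_Ici]
    positivity

theorem boxApprox_of_notMem {x : ∀ i, X i} (hx : ¬ ∀ i, x i ∈ S i) : boxApprox S t p x = 0 := by
  push Not at hx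
  obtain ⟨i, hi⟩ := hx
  refine prod_eq_zero (mem_univ i) ?_
  obtain rfl | hit := eq_or_ne i t
  · rw [boxFactor, Function.update_self]
    refine sum_eq_zero fun y hy => absurd ?_ hi
    obtain ⟨hyS, hyx⟩ := mem_filter.1 hy
    exact hyx ▸ Fintype.mem_piFinset.1 hyS i
  · rw [boxFactor, Function.update_of_ne hit, if_neg hi]

theorem boxApprox_of_mem {x : ∀ i, X i} (hx : ∀ i, x i ∈ S i) :
    boxApprox S t p x =
      (∑ y ∈ Fintype.piFinset S with y t = x t, p y) / ∏ i ∈ univ.erase t, (#(S i) : ℝ) := by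
  rw [boxApprox, ← mul_prod_erase _ _ (mem_univ t), boxFactor, Function.update_self, div_eq_mul_inv,
    ← prod_inv_distrib]
  congr 1
  refine prod_congr rfl fun i hi => ?_
  rw [Function.update_of_ne (ne_of_mem_erase hi), if_pos (hx i)]

theorem le_prod_card_mul_boxApprox (hp : ∀ x, 0 ≤ p x) {x : ∀ i, X i} (hx : ∀ i, x i ∈ S i) :
    p x ≤ (∏ i ∈ univ.erase t, (#(S i) : ℝ)) * boxApprox S t p x := by
  have h_card : ∏ i ∈ univ.erase t, (#(S i) : ℝ) ≠ 0 :=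
    prod_ne_zero_iff.2 fun i _ => Nat.cast_ne_zero.2 (card_ne_zero_of_mem (hx i))
  rw [boxApprox_of_mem hx, mul_div_cancel₀ _ h_card]
  exact single_le_sum (f := p) (fun y _ => hp y) (by simpa using hx)

theorem sum_boxApprox [∀ i, Fintype (X i)] :
    ∑ x, boxApprox S t p x = ∑ x ∈ Fintype.piFinset S, p x := by
  have h_sum_uniform : ∀ i ∈ univ.erase t, ∑ a, boxFactor S t p i a = #(S i) * (#(S i) : ℝ)⁻¹ := by
    intro i hi
    simp [boxFactor, Function.update_of_ne (ne_of_mem_erase hi)]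
  simp only [boxApprox]
  rw [← Fintype.prod_sum, ← mul_prod_erase _ _ (mem_univ t), prod_congr rfl h_sum_uniform,
    boxFactor, Function.update_self, sum_fiberwise]
  obtain hS | ⟨x, hx⟩ := (Fintype.piFinset S).eq_empty_or_nonempty
  · simp [hS]
  · have h_card : ∀ i, (#(S i) : ℝ) ≠ 0 := fun i =>
      Nat.cast_ne_zero.2 (card_ne_zero_of_mem (Fintype.mem_piFinset.1 hx i))
    rw [prod_eq_one fun i _ => mul_inv_cancel₀ (h_card i), mul_one]

end BoxApprox

end Boxes

section Bounds

variable {n m : ℕ} {X : Fin n → Type*} {H : Fin m → Type*} [∀ i, Fintype (X i)]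
  [∀ j, Fintype (H j)] [∀ j, Nonempty (H j)]

theorem sum_boxApprox_mem_closure_RBM [∀ i, DecidableEq (X i)] {κ : Type*} [Fintype κ]
    (hκ : Fintype.card κ ≤ 1 + ∑ j, (Fintype.card (H j) - 1)) (P : BoxPartition X κ)
    (t : κ → Fin n) {p : (∀ i, X i) → ℝ} (hp : p ∈ stdSimplex ℝ (∀ i, X i)) :
    ∑ k, boxApprox (P.box k) (t k) p ∈ closure (RBM X H) := by
  classical
  obtain ⟨x₀⟩ : Nonempty (∀ i, X i) := by
    by_contra h_empty
    rw [not_nonempty_iff] at h_empty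
    simpa using hp.2
  have : Nonempty (Fin n) := ⟨t (P.part x₀)⟩
  have h_zero : ∀ {k x}, P.part x ≠ k → boxApprox (P.box k) (t k) p x = 0 := fun hx =>
    boxApprox_of_notMem (mt P.part_eq_iff.2 hx)
  have h_disj : Pairwise fun k l =>
      boxApprox (P.box k) (t k) p * boxApprox (P.box l) (t l) p = 0 := by
    intro k l hkl
    funext x
    by_cases hx : P.part x = k
    · simp [h_zero (hx.trans_ne hkl)]
    · simp [h_zero hx]
  have h_fiber : ∀ k, Fintype.piFinset (P.box k) = univ.filter fun x => P.part x = k := fun k => by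
    ext x
    simp [P.part_eq_iff]
  have h_sum : ∑ x, (∑ k, boxApprox (P.box k) (t k) p) x = 1 := by
    simp only [Finset.sum_apply]
    rw [sum_comm]
    simp only [sum_boxApprox, h_fiber]
    exact (sum_fiberwise univ P.part p).trans hp.2
  exact mem_closure_RBM_of_mem_closure_rbmWeights (sum_mem_closure_rbmWeights hκ
    (fun k => boxApprox_mem_productFunctions hp.1) h_disj) h_sum

theorem divFrom_RBM_le_of_boxPartition {κ : Type*} [Fintype κ]
    (hκ : Fintype.card κ ≤ 1 + ∑ j, (Fintype.card (H j) - 1)) (P : BoxPartition X κ)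
    (t : κ → Fin n) {p : (∀ i, X i) → ℝ} (hp : p ∈ stdSimplex ℝ (∀ i, X i)) :
    divFrom p (RBM X H) ≤ ((∑ x, p x *
      ∑ i ∈ univ.erase (t (P.part x)), Real.log #(P.box (P.part x) i) : ℝ) : EReal) := by
  classical
  have h_card : ∀ x i, (#(P.box (P.part x) i) : ℝ) ≠ 0 := fun x i =>
    Nat.cast_ne_zero.2 (card_ne_zero_of_mem (P.mem_box_part x i))
  simp only [← Real.log_prod fun i _ => h_card _ i]
  refine (divFrom_le_kl_of_mem_closure (sum_boxApprox_mem_closure_RBM hκ P t hp)).trans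
    (kl_le_sum_mul_log_of_le_mul hp.1 (fun x => ?_) fun x => ?_)
  · exact prod_pos fun i _ => (Nat.cast_nonneg _).lt_of_ne' (h_card x i)
  · refine (le_prod_card_mul_boxApprox (t := t (P.part x)) hp.1 (P.mem_box_part x)).trans ?_
    rw [Finset.sum_apply]
    gcongr
    have h_nonneg : ∀ k, 0 ≤ boxApprox (P.box k) (t k) p x := fun k => by
      obtain ⟨f, hf, hfp⟩ := boxApprox_mem_productFunctions (S := P.box k) (t := t k) hp.1
      exact hfp ▸ prod_nonneg fun i _ => hf i (x i)
    exact single_le_sum (f := fun k => boxApprox (P.box k) (t k) p x) (fun k _ => h_nonneg k)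
      (mem_univ _)

variable [∀ i, Nonempty (X i)]

theorem maxDiv_RBM_le_log_div {A : Finset (Fin n)} (hA : A.Nonempty)
    (h : ∏ i ∈ Aᶜ, Fintype.card (X i) ≤ 1 + ∑ j, (Fintype.card (H j) - 1)) :
    maxDiv (RBM X H) ≤ ((Real.log ((∏ i ∈ A, (Fintype.card (X i) : ℝ)) /
      A.sup' hA (fun j => (Fintype.card (X j) : ℝ))) : ℝ) : EReal) := by
  obtain ⟨t, ht, h_sup⟩ := A.exists_mem_eq_sup' hA fun j => (Fintype.card (X j) : ℝ)
  have h_card : ∀ i, (Fintype.card (X i) : ℝ) ≠ 0 := fun i =>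
    Nat.cast_ne_zero.2 Fintype.card_ne_zero
  have hκ : Fintype.card (∀ i : (Aᶜ : Finset (Fin n)), X i) ≤
      1 + ∑ j, (Fintype.card (H j) - 1) := by
    rwa [Fintype.card_pi, prod_coe_sort Aᶜ fun i => Fintype.card (X i)]
  have h_free : univ.erase t \ Aᶜ = A.erase t := by
    rw [erase_sdiff_comm, ← compl_eq_univ_sdiff, compl_compl]
  refine iSup₂_le fun p hp =>
    (divFrom_RBM_le_of_boxPartition hκ (.cylinders Aᶜ) (fun _ => t) hp).trans_eq ?_
  simp only [BoxPartition.sum_log_card_box_cylinders, ← sum_mul, hp.2, one_mul]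
  rw [h_sup, h_free, ← mul_prod_erase A _ ht, mul_div_cancel_left₀ _ (h_card t),
    Real.log_prod fun i _ => h_card i]

/-- The `r` heaviest of the cylinders over `B` are split along the coordinate `j`; they carry at
least the fraction `r / N_B` of the mass. -/
theorem maxDiv_RBM_le_sub_div_mul_log {B : Finset (Fin n)} {j t : Fin n} (hj : j ∉ B)
    (hjt : j ≠ t) {r : ℕ} (hr : r ≤ ∏ i ∈ B, Fintype.card (X i))
    (h : ∏ i ∈ B, Fintype.card (X i) + r * (Fintype.card (X j) - 1) ≤
      1 + ∑ l, (Fintype.card (H l) - 1)) :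
    maxDiv (RBM X H) ≤ ((∑ i ∈ Bᶜ.erase t, Real.log (Fintype.card (X i)) -
      r / (∏ i ∈ B, (Fintype.card (X i) : ℝ)) * Real.log (Fintype.card (X j)) : ℝ) : EReal) := by
  classical
  refine iSup₂_le fun p hp => ?_
  have h_card : Fintype.card (∀ i : B, X i) = ∏ i ∈ B, Fintype.card (X i) := by
    rw [Fintype.card_pi, prod_coe_sort B fun i => Fintype.card (X i)]
  let P : BoxPartition X (∀ i : B, X i) := .cylinders B
  obtain ⟨R, hRr, hR⟩ := exists_card_eq_and_div_card_le_sum_filter hp P.part (h_card ▸ hr)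
  have hκ : Fintype.card ({k // k ∉ R} ⊕ {k // k ∈ R} × X j) ≤
      1 + ∑ l, (Fintype.card (H l) - 1) := by
    refine le_of_eq_of_le ?_ h
    rw [Fintype.card_sum, Fintype.card_prod, Fintype.card_subtype_compl, Fintype.card_coe, h_card,
      hRr]
    obtain ⟨N, hN⟩ := Nat.exists_eq_succ_of_ne_zero (Fintype.card_ne_zero (α := X j))
    rw [hN, Nat.succ_sub_one, Nat.mul_succ]
    lia
  refine (divFrom_RBM_le_of_boxPartition hκ (P.split R j) (fun _ => t) hp).trans
    (EReal.coe_le_coe_iff.2 ?_)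
  have h_free : univ.erase t \ B = Bᶜ.erase t := by rw [erase_sdiff_comm, ← compl_eq_univ_sdiff]
  have h_box_j : ∀ k, #(P.box k j) = Fintype.card (X j) := fun k => by
    simp [P, BoxPartition.cylinders, hj]
  simp only [P.sum_log_card_box_split R (mem_erase.2 ⟨hjt, mem_univ j⟩), h_box_j, P,
    BoxPartition.sum_log_card_box_cylinders, h_free, mul_sub, sum_sub_distrib, ← sum_mul, hp.2,
    one_mul, mul_ite, mul_zero, ← sum_filter]
  gcongr
  rw [h_card, Nat.cast_prod] at hR
  exact hR

theorem maxDiv_RBM_le_sub_div_pow_mul_log_two (hX : ∀ i, Fintype.card (X i) = 2) {k r : ℕ}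
    (hk : k + 1 < n) (hr : r ≤ 2 ^ k) (h : 2 ^ k + r ≤ 1 + ∑ j, (Fintype.card (H j) - 1)) :
    maxDiv (RBM X H) ≤ ((((n : ℝ) - (k + 1) - r / 2 ^ k) * Real.log 2 : ℝ) : EReal) := by
  obtain ⟨B, -, hB⟩ := exists_subset_card_eq (s := (univ : Finset (Fin n))) (n := k)
    (by simpa using by lia)
  have hB_compl : #Bᶜ = n - k := by rw [card_compl, Fintype.card_fin, hB]
  obtain ⟨j, hj, t, ht, hjt⟩ := one_lt_card.1 (show 1 < #Bᶜ by lia)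
  refine (maxDiv_RBM_le_sub_div_mul_log (B := B) (r := r) (mem_compl.1 hj) hjt
    (by simpa [hX, hB] using hr) (by simpa [hX, hB] using h)).trans_eq ?_
  have h_free : (#(Bᶜ.erase t) : ℝ) = n - (k + 1) := by
    rw [card_erase_of_mem ht, hB_compl, Nat.sub_sub, Nat.cast_sub hk.le, Nat.cast_add_one]
  simp [hX, hB, h_free, sub_mul]

theorem maxDiv_RBM_le_sub_log_sub_div_mul_log_two (hX : ∀ i, Fintype.card (X i) = 2) (hn : 1 ≤ n)
    {d : ℕ} (hdH : d ≤ ∑ j, (Fintype.card (H j) - 1)) (hd : d ≤ 2 ^ (n - 1) - 1) :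
    maxDiv (RBM X H) ≤
      ((((n : ℝ) - (Nat.log 2 (d + 1) : ℝ) - ((d : ℝ) + 1) / 2 ^ Nat.log 2 (d + 1)) *
        Real.log 2 : ℝ) : EReal) := by
  have h_pow : 0 < 2 ^ (n - 1) := by positivity
  have h_le : 2 ^ Nat.log 2 (d + 1) ≤ d + 1 := Nat.pow_log_le_self 2 d.succ_ne_zero
  have h_lt : d + 1 < 2 ^ (Nat.log 2 (d + 1) + 1) := Nat.lt_pow_succ_log_self one_lt_two _
  have h_log : Nat.log 2 (d + 1) ≤ n - 1 :=
    (Nat.pow_le_pow_iff_right one_lt_two).1 (h_le.trans (by lia))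
  generalize Nat.log 2 (d + 1) = k at h_le h_lt h_log ⊢
  rw [pow_succ] at h_lt
  obtain hk | rfl := h_log.lt_or_eq
  · refine (maxDiv_RBM_le_sub_div_pow_mul_log_two hX (k := k) (r := d + 1 - 2 ^ k) (by lia)
      (by lia) (by lia)).trans_eq (congrArg Real.toEReal ?_)
    rw [Nat.cast_sub h_le]
    push_cast
    field_simp
    ring
  · have hd_eq : (d : ℝ) + 1 = 2 ^ (n - 1) := by exact_mod_cast (by lia : d + 1 = 2 ^ (n - 1))
    refine (maxDiv_RBM_le_log_div (singleton_nonempty ⟨0, hn⟩) ?_).trans_eq ?_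
    · simp only [hX, prod_const, card_compl, card_singleton, Fintype.card_fin]
      lia
    · simp [hX, hd_eq, Nat.cast_sub hn]

end Bounds

end InfoDiv

theorem mainTheorem2_general (n m : ℕ)
    (X : Fin n → Type*) [∀ i, Fintype (X i)] [∀ i, Nonempty (X i)]
    (H : Fin m → Type*) [∀ j, Fintype (H j)] [∀ j, Nonempty (H j)] :
    (∀ (A : Finset (Fin n)) (hA : A.Nonempty),
      ∏ i ∈ Aᶜ, Fintype.card (X i) ≤ 1 + ∑ j, (Fintype.card (H j) - 1) →
      InfoDiv.maxDiv (InfoDiv.RBM X H) ≤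
        ((Real.log ((∏ i ∈ A, (Fintype.card (X i) : ℝ)) /
          A.sup' hA (fun j => (Fintype.card (X j) : ℝ))) : ℝ) : EReal)) ∧
    ((∀ i, Fintype.card (X i) = 2) → 1 ≤ n →
      ∀ d ≤ ∑ j, (Fintype.card (H j) - 1), d ≤ 2 ^ (n - 1) - 1 →
      InfoDiv.maxDiv (InfoDiv.RBM X H) ≤
        ((((n : ℝ) - (Nat.log 2 (d + 1) : ℝ) - ((d : ℝ) + 1) / 2 ^ Nat.log 2 (d + 1)) *
          Real.log 2 : ℝ) : EReal)) :=
  ⟨fun _ hA => InfoDiv.maxDiv_RBM_le_log_div hA, fun hX hn _ =>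
    InfoDiv.maxDiv_RBM_le_sub_log_sub_div_mul_log_two hX hn⟩

theorem mainTheorem2 (n m : ℕ)
    (X : Fin n → Type*) [∀ i, Fintype (X i)] [∀ i, Nonempty (X i)]
    (H : Fin m → Type*) [∀ j, Fintype (H j)] [∀ j, Nonempty (H j)] :
    (∀ (A : Finset (Fin n)) (hA : A.Nonempty),
      ∏ i ∈ Aᶜ, Fintype.card (X i) ≤ 1 + ∑ j, (Fintype.card (H j) - 1) →
      InfoDiv.maxDiv (InfoDiv.RBM X H) ≤
        ((Real.log ((∏ i ∈ A, (Fintype.card (X i) : ℝ)) /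
          A.sup' hA (fun j => (Fintype.card (X j) : ℝ))) : ℝ) : EReal)) ∧
    ((∀ i, Fintype.card (X i) = 2) → (∀ j, Fintype.card (H j) = 2) →
      1 ≤ n → m ≤ 2 ^ (n - 1) - 1 →
      InfoDiv.maxDiv (InfoDiv.RBM X H) ≤
        ((((n : ℝ) - (Nat.log 2 (m + 1) : ℝ) - ((m : ℝ) + 1) / 2 ^ Nat.log 2 (m + 1)) *
          Real.log 2 : ℝ) : EReal)) := by
  refine (mainTheorem2_general n m X H).imp_right fun h hX hH hn hm => h hX hn m ?_ hm
  simp [hH]
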